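/- Let $k$ be an uncountable field and let $A$ be a finitely generated (associative, unital, not necessarily commutative) $k$-algebra that is a domain, satisfies no polynomial identity (no nonzero noncommutative polynomial over $k$ vanishes under all substitutions from $A$), and has Gelfand–Kirillov dimension $\sup_V \limsup_{n\to\infty} \log(\dim_k V^n)/\log n$ strictly less than $3$, where $V$ ranges over the finite-dimensional $k$-subspaces of $A$ containing $1$. Suppose that $A$ is not algebraic over $k$. Then $A$ has a quotient division algebra $Q(A)$, that is, a division $k$-algebra containing $A$ in which every element has the form $as^{-1}$ with $a,s\in A$, $s\neq 0$; and for every $x\in A$ which is transcendental over $k$, $Q(A)$ is neither left algebraic nor right algebraic over the subfield $k(x)$ of $Q(A)$ generated by $k$ and $x$. Here, for a division subring $E$ of a division ring $D$, an element $b\in D$ is left (respectively right) algebraic over $E$ if there are $n \ge 0$ and $e_0,\dots,e_n\in E$, not all zero, with $\sum_{i=0}^n e_i b^i=0$ (respectively $\sum_{i=0}^n b^i e_i=0$), and $D$ is left (respectively right) algebraic over $E$ if every element of $D$ is. -/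

import Mathlib

universe u v w

/-- A `k`-algebra `A` satisfies a polynomial identity (is PI) if some nonzero noncommutative
polynomial over `k` vanishes under every substitution of its variables by elements of `A`. -/
def SatisfiesPolynomialIdentity (k : Type u) (A : Type v) [Field k] [Ring A] [Algebra k A] :
    Prop :=
  ∃ f : FreeAlgebra k ℕ, f ≠ 0 ∧ ∀ a : ℕ → A, FreeAlgebra.lift k a f = 0

/-- The Gelfand-Kirillov dimension of a `k`-algebra `A`: the supremum, over all
finite-dimensional `k`-subspaces `V` of `A` containing `1`, of
`limsup_{n → ∞} log (dim_k V ^ n) / log n`. -/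
noncomputable def gkDim (k : Type u) (A : Type v) [Field k] [Ring A] [Algebra k A] : EReal :=
  ⨆ (V : Submodule k A) (_ : Module.Finite k V) (_ : (1 : A) ∈ V),
    Filter.limsup
      (fun n : ℕ =>
        ((Real.log (Module.finrank k (V ^ n : Submodule k A)) / Real.log n : ℝ) : EReal))
      Filter.atTop

/-- `ι : A → D` exhibits the division algebra `D` as the (right) quotient division algebra of
`A`: `ι` is injective and each element of `D` is a right fraction `ι a * (ι s)⁻¹` with
`a, s ∈ A` and `s ≠ 0`. -/
structure IsQuotientDivisionAlgebra {k : Type u} {A : Type v} {D : Type w} [Field k] [Ring A]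
    [Algebra k A] [DivisionRing D] [Algebra k D] (ι : A →ₐ[k] D) : Prop where
  injective : Function.Injective ι
  exists_fraction : ∀ d : D, ∃ a s : A, s ≠ 0 ∧ d = ι a * (ι s)⁻¹

/-- The division subring `k(y)` of `D` generated by `k` and an element `y`. (In Mathlib a
`Subfield` of a division ring is a division subring; this one is commutative because `k` is
central.) -/
def adjoinSimple (k : Type u) {D : Type w} [Field k] [DivisionRing D] [Algebra k D] (y : D) :
    Subfield D :=
  Subfield.closure (Set.range (algebraMap k D) ∪ {y})

/-- `b` is left algebraic over the division subring `E`: the sum `∑ E b ^ i` is not direct, that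
is, there are finitely many coefficients in `E`, not all zero, with `∑ e i * b ^ i = 0`. -/
def IsLeftAlgebraicElem {D : Type w} [DivisionRing D] (E : Subfield D) (b : D) : Prop :=
  ∃ e : ℕ →₀ E, e ≠ 0 ∧ (e.sum fun i c => (c : D) * b ^ i) = 0

/-- `b` is right algebraic over the division subring `E`: there are finitely many coefficients
in `E`, not all zero, with `∑ b ^ i * e i = 0`. -/
def IsRightAlgebraicElem {D : Type w} [DivisionRing D] (E : Subfield D) (b : D) : Prop :=
  ∃ e : ℕ →₀ E, e ≠ 0 ∧ (e.sum fun i c => b ^ i * (c : D)) = 0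

/-- `D` is left algebraic over `E`: every element of `D` is. -/
def IsLeftAlgebraicOver {D : Type w} [DivisionRing D] (E : Subfield D) : Prop :=
  ∀ b : D, IsLeftAlgebraicElem E b

/-- `D` is right algebraic over `E`: every element of `D` is. -/
def IsRightAlgebraicOver {D : Type w} [DivisionRing D] (E : Subfield D) : Prop :=
  ∀ b : D, IsRightAlgebraicElem E b

/-! ### Growth below cubic, common multiples and the quotient division algebra. -/

section Growth

variable {k : Type u} {A : Type v} [Field k] [Ring A] [Algebra k A]

/-! Two nonzero right ideals `aA` and `bA` meeting in zero would force exponential growth. So `A` is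
Ore on both sides and `Q(A)` exists.

Suppose now that `D = Q(A)` is left algebraic over `K = k(x)`. Algebraicity of conjugates `u * x *
u⁻¹` allows a finite generating set of `A` (the letters) whose left `K`-span is stable under right
multiplication by `K`. Call a word irreducible if its value is not a left `K`-combination of values
of shortlex-smaller words. The values of irreducible words are a left `K`-basis of `K * A`, and
factors of irreducible words are irreducible.

If there are finitely many irreducible words, `K * A` has finite left dimension. Then `A` acts
faithfully on it by right multiplication and embeds in matrices over the commutative field `K`, so
it is PI.

If there are infinitely many, there are at least `m + 1` of each length `m`: otherwise König's lemma
and Morse-Hedlund give an eventually periodic infinite word with irreducible factors, yet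
algebraicity makes some power of the period reducible. Multiplying the quadratically many
irreducible words of length at most `n` by `x ^ i`, `i ≤ n`, gives cubic growth, against `gkDim k A
< 3`. The right-handed case follows by passing to opposite algebras. -/

theorem exists_finrank_pow_le_rpow_of_gkDim_lt (h : gkDim k A < 3) (V : Submodule k A)
    [hV : Module.Finite k V] (h1 : (1 : A) ∈ V) :
    ∃ c : ℝ, c < 3 ∧ ∀ᶠ n : ℕ in Filter.atTop,
      (Module.finrank k (V ^ n : Submodule k A) : ℝ) ≤ (n : ℝ) ^ c := by
  have hle := (le_iSup₂_of_le (f := fun (V : Submodule k A) (_ : Module.Finite k V) =>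
    ⨆ (_ : (1 : A) ∈ V), Filter.limsup (fun n : ℕ =>
        ((Real.log (Module.finrank k (V ^ n : Submodule k A)) / Real.log n : ℝ) : EReal))
      Filter.atTop) V hV (le_iSup_of_le h1 le_rfl)).trans_lt h
  obtain ⟨c, hc, hc3⟩ := EReal.lt_iff_exists_real_btwn.1 hle
  refine ⟨c, EReal.coe_lt_coe_iff.1 hc3, ?_⟩
  filter_upwards [Filter.eventually_lt_of_limsup_lt hc, Filter.eventually_ge_atTop 2] with n hn h2
  have hn' := EReal.coe_lt_coe_iff.1 hn
  have h2' : (2 : ℝ) ≤ n := by exact_mod_cast h2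
  have hlog : 0 < Real.log n := Real.log_pos (by linarith)
  rw [div_lt_iff₀ hlog] at hn'
  rcases Nat.eq_zero_or_pos (Module.finrank k (V ^ n : Submodule k A)) with h0 | h0
  · rw [h0]; push_cast; positivity
  · rw [Real.rpow_def_of_pos (by linarith), mul_comm, ← Real.log_le_iff_le_exp (by exact_mod_cast h0)]
    exact hn'.le

theorem gkDim_mulOpposite_le : gkDim k Aᵐᵒᵖ ≤ gkDim k A := by
  refine iSup_le fun V => iSup_le fun hV => iSup_le fun h1 => ?_
  let e : A ≃ₗ[k] Aᵐᵒᵖ := MulOpposite.opLinearEquiv k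
  have key : ∀ W : Submodule k Aᵐᵒᵖ,
      Nonempty ((W.comap (e : A →ₗ[k] Aᵐᵒᵖ)) ≃ₗ[k] W) := fun W => by
    rw [Submodule.comap_equiv_eq_map_symm]
    exact ⟨(e.symm.submoduleMap W).symm⟩
  refine le_iSup_of_le (V.comap (e : A →ₗ[k] Aᵐᵒᵖ)) (le_iSup_of_le ?_ (le_iSup_of_le ?_ ?_))
  · obtain ⟨f⟩ := key V
    exact Module.Finite.equiv f.symm
  · simpa [e] using h1
  · refine le_of_eq ?_
    congr 1
    ext n
    obtain ⟨f⟩ := key (V ^ n)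
    rw [← f.finrank_eq]
    rw [← Submodule.comap_op_pow]

/-- `a * V ^ n` and `b * V ^ n` lie in `V ^ (n + 1)`, meet only in zero, and each has the dimension
of `V ^ n` because `A` is a domain; so the dimension at least doubles. -/
theorem two_pow_le_finrank_pow [IsDomain A] {a b : A} (ha : a ≠ 0) (hb : b ≠ 0)
    (h : ∀ r s, a * r = b * s → r = 0) (n : ℕ) :
    2 ^ n ≤ Module.finrank k ((Submodule.span k {1, a, b}) ^ n : Submodule k A) := by
  set V : Submodule k A := Submodule.span k {1, a, b} with hV
  have hfin : V.FG := Submodule.fg_span (by simp)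
  have hVn : ∀ n, Module.Finite k (V ^ n : Submodule k A) := fun n =>
    Module.Finite.iff_fg.2 (hfin.pow n)
  induction n with
  | zero => 
    rw [pow_zero, pow_zero, Submodule.one_eq_span, finrank_span_singleton one_ne_zero]
  | succ n ih =>
    have hmap : ∀ c : A, c ≠ 0 → c ∈ V →
        (V ^ n).map (LinearMap.mulLeft k c) ≤ V ^ (n + 1) ∧
        Module.finrank k ((V ^ n).map (LinearMap.mulLeft k c)) =
          Module.finrank k (V ^ n : Submodule k A) := by
      intro c hc hcV
      constructor
      · rintro _ ⟨y, hy, rfl⟩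
        rw [pow_succ']
        exact Submodule.mul_mem_mul hcV hy
      · exact (Submodule.equivMapOfInjective (LinearMap.mulLeft k c)
          (fun y z hyz => mul_left_cancel₀ hc hyz) (V ^ n)).finrank_eq.symm
    obtain ⟨ha1, ha2⟩ := hmap a ha (Submodule.subset_span (by simp))
    obtain ⟨hb1, hb2⟩ := hmap b hb (Submodule.subset_span (by simp))
    have hfa : Module.Finite k ((V ^ n).map (LinearMap.mulLeft k a)) := inferInstance
    have hfb : Module.Finite k ((V ^ n).map (LinearMap.mulLeft k b)) := inferInstance
    have hsum := Submodule.finrank_sup_add_finrank_inf_eq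
      ((V ^ n).map (LinearMap.mulLeft k a)) ((V ^ n).map (LinearMap.mulLeft k b))
    have hinf : (V ^ n).map (LinearMap.mulLeft k a) ⊓ (V ^ n).map (LinearMap.mulLeft k b) = ⊥ := by
      rw [eq_bot_iff]
      rintro _ ⟨⟨r, -, rfl⟩, ⟨s, -, hs⟩⟩
      have := h r s hs.symm
      simp [this]
    have hle := Submodule.finrank_mono (sup_le ha1 hb1)
    rw [hinf, finrank_bot, ha2, hb2] at hsum
    rw [pow_succ]
    omega

theorem exists_common_right_multiple_of_gkDim_lt [IsDomain A] (hGK : gkDim k A < 3) {a b : A}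
    (ha : a ≠ 0) (hb : b ≠ 0) : ∃ r s : A, r ≠ 0 ∧ a * r = b * s := by
  by_contra! hcon
  have h : ∀ r s, a * r = b * s → r = 0 := fun r s hrs => by
    by_contra hr
    exact hcon r s hr hrs
  obtain ⟨c, hc, hev⟩ := exists_finrank_pow_le_rpow_of_gkDim_lt hGK (Submodule.span k {1, a, b})
    (hV := Module.Finite.iff_fg.2 (Submodule.fg_span (by simp))) (Submodule.subset_span (by simp))
  have hlim := (tendsto_pow_const_div_const_pow_of_one_lt 3 (r := (2 : ℝ)) (by norm_num)).eventually
    (gt_mem_nhds one_pos)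
  obtain ⟨n, hn1, hn2, hn3⟩ := (hev.and (hlim.and (Filter.eventually_ge_atTop 1))).exists
  have h1 : ((2 : ℝ)) ^ n ≤ (n : ℝ) ^ c :=
    le_trans (by exact_mod_cast two_pow_le_finrank_pow ha hb h n) hn1
  have hn3' : (1 : ℝ) ≤ n := by exact_mod_cast hn3
  have h2 : (n : ℝ) ^ c ≤ (n : ℝ) ^ 3 := by
    rw [← Real.rpow_natCast]
    exact Real.rpow_le_rpow_of_exponent_le hn3' (by push_cast; exact hc.le)
  rw [div_lt_one (by positivity)] at hn2
  linarith

open OreLocalization nonZeroDivisors in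
theorem exists_isQuotientDivisionAlgebra [IsDomain A] (hGK : gkDim k A < 3) :
    ∃ (D : Type v) (_ : DivisionRing D) (_ : Algebra k D) (ι : A →ₐ[k] D),
      IsQuotientDivisionAlgebra ι := by
  -- `OreLocalization` is built from left fractions, so the left Ore condition is needed; it is the
  -- right one for the opposite algebra.
  have hleft : ∀ (r : A) (s : A⁰), ∃ (r' : A) (s' : A⁰), s' * r = r' * s := by
    intro r s
    by_cases hr : r = 0
    · exact ⟨0, 1, by simp [hr]⟩
    · obtain ⟨p, q, hp, hpq⟩ := exists_common_right_multiple_of_gkDim_lt (k := k)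
        (gkDim_mulOpposite_le.trans_lt hGK)
        (MulOpposite.op_ne_zero_iff r |>.2 hr)
        (MulOpposite.op_ne_zero_iff (s : A) |>.2 (nonZeroDivisors.coe_ne_zero s))
      refine ⟨q.unop, ⟨p.unop, mem_nonZeroDivisors_of_ne_zero (by simpa using hp)⟩, ?_⟩
      simpa using congrArg MulOpposite.unop hpq
  obtain ⟨hOre⟩ := OreLocalization.nonempty_oreSet_iff_of_noZeroDivisors.2 hleft
  let ι : A →ₐ[k] A[A⁰⁻¹] := { numeratorRingHom with commutes' := fun c => rfl }
  have hι : ∀ a, ι a = a /ₒ 1 := fun _ => rfl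
  have hinj : Function.Injective ι := numeratorHom_inj fun a ha => ha.1
  refine ⟨A[A⁰⁻¹], inferInstance, inferInstance, ι, hinj, fun d => ?_⟩
  induction d using OreLocalization.ind with
  | _ r s =>
  have hs0 : (s : A) ≠ 0 := nonZeroDivisors.coe_ne_zero s
  have hιs : ι s ≠ 0 := (map_ne_zero_iff ι hinj).2 hs0
  have hrs : ι s * (r /ₒ s) = ι r := by
    rw [hι, hι]
    exact OreLocalization.mul_cancel
  by_cases hr : r = 0
  · exact ⟨0, 1, one_ne_zero, by simp [hr]⟩
  -- A left fraction becomes a right one: `r * t = s * q` gives `s⁻¹ * r = q * t⁻¹`.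
  · obtain ⟨t, q, ht, htq⟩ := exists_common_right_multiple_of_gkDim_lt hGK hr hs0
    refine ⟨q, t, ht, ?_⟩
    have hιt : ι t ≠ 0 := (map_ne_zero_iff ι hinj).2 ht
    rw [eq_mul_inv_iff_mul_eq₀ hιt]
    apply mul_left_cancel₀ hιs
    rw [← mul_assoc, hrs, ← map_mul, htq, map_mul]

end Growth

/-! ### Standard identities for rings embedded in finite-dimensional algebras. -/

section StandardPolynomial

/-- The standard polynomial `∑ sign σ • X_{σ 0} ⋯ X_{σ (N - 1)}`. -/
noncomputable def standardPolynomial (k : Type u) [Field k] (N : ℕ) : FreeAlgebra k ℕ :=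
  ∑ σ : Equiv.Perm (Fin N), Equiv.Perm.sign σ •
    (List.ofFn fun i => FreeAlgebra.ι k ((σ i : Fin N) : ℕ)).prod

theorem lift_standardPolynomial {k : Type u} [Field k] {B : Type v} [Ring B] [Algebra k B] (N : ℕ)
    (a : ℕ → B) : FreeAlgebra.lift k a (standardPolynomial k N) =
      ∑ σ : Equiv.Perm (Fin N), Equiv.Perm.sign σ • (List.ofFn fun i => a (σ i : Fin N)).prod := by
  simp only [standardPolynomial, map_sum, Units.smul_def, map_zsmul, map_list_prod, List.map_ofFn]
  refine Finset.sum_congr rfl fun σ _ => ?_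
  congr 3
  ext i
  simp

/-- In the monoid algebra of the free monoid, only the identity permutation contributes to the
coefficient of `X_0 ⋯ X_{N-1}`. -/
theorem standardPolynomial_ne_zero (k : Type u) [Field k] (N : ℕ) : standardPolynomial k N ≠ 0 := by
  intro h
  have h1 := lift_standardPolynomial (k := k) N
    (fun i => MonoidAlgebra.of k (FreeMonoid ℕ) (FreeMonoid.of i))
  have h2 : ∀ l : List ℕ, (l.map fun i =>
      MonoidAlgebra.of k (FreeMonoid ℕ) (FreeMonoid.of i)).prod =
        MonoidAlgebra.of k (FreeMonoid ℕ) (FreeMonoid.ofList l) := fun l => by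
    induction l with
    | nil => rw [List.map_nil, List.prod_nil, FreeMonoid.ofList_nil, map_one]
    | cons a l ih => rw [List.map_cons, List.prod_cons, ih, FreeMonoid.ofList_cons, map_mul]
  have h3 : ∀ σ : Equiv.Perm (Fin N),
      (List.ofFn fun i => MonoidAlgebra.of k (FreeMonoid ℕ) (FreeMonoid.of ((σ i : Fin N) : ℕ))).prod
        = MonoidAlgebra.of k (FreeMonoid ℕ)
          (FreeMonoid.ofList (List.ofFn fun i => ((σ i : Fin N) : ℕ))) := fun σ => by
    rw [← h2, List.map_ofFn]
    rfl
  simp only [h, map_zero, h3] at h1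
  have h4 := congrArg (fun q => q.coeff (FreeMonoid.ofList (List.ofFn fun i : Fin N => (i : ℕ)))) h1
  simp only [MonoidAlgebra.coeff_sum, Finsupp.coe_finsetSum, Finset.sum_apply] at h4
  rw [Finset.sum_eq_single 1] at h4
  · simp at h4
  · intro σ _ hσ
    have : FreeMonoid.ofList (List.ofFn fun i => ((σ i : Fin N) : ℕ)) ≠
        FreeMonoid.ofList (List.ofFn fun i : Fin N => (i : ℕ)) := fun he => hσ <| by
      ext i
      exact congrFun (List.ofFn_injective (FreeMonoid.ofList.injective he)) i
    simp [Units.smul_def, this]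
  · simp

/-- The standard polynomial is alternating and `F`-multilinear on `E`, so it vanishes on more than
`dim_F E` arguments. Its coefficients are `±1`, so `φ` need only be a ring homomorphism, with no
relation between `k` and `F`. -/
theorem satisfiesPolynomialIdentity_of_injective_ringHom {k : Type u} {A : Type v} [Field k] [Ring A]
    [Algebra k A] {F E : Type*} [Field F] [Ring E] [Algebra F E] [Module.Finite F E]
    (φ : A →+* E) (hφ : Function.Injective φ) : SatisfiesPolynomialIdentity k A := by
  refine ⟨standardPolynomial k (Module.finrank F E + 1), standardPolynomial_ne_zero k _,
    fun a => hφ ?_⟩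
  set N := Module.finrank F E + 1
  have h := AlternatingMap.map_linearDependent
    (MultilinearMap.alternatization (MultilinearMap.mkPiAlgebraFin F N E))
    (fun i : Fin N => φ (a i)) (fun hli => by
      have := hli.fintype_card_le_finrank
      simp [N] at this)
  rw [MultilinearMap.alternatization_apply] at h
  rw [lift_standardPolynomial, map_zero, map_sum, ← h]
  refine Finset.sum_congr rfl fun σ _ => ?_
  simp [Units.smul_def, map_list_prod, List.map_ofFn, Function.comp_def]

end StandardPolynomial

/-! ### König's lemma and Morse-Hedlund for infinite words. -/

section InfiniteWords

/-- The factor `s i, s (i + 1), …, s (i + n - 1)` of the infinite word `s`. -/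
def wordFactor {J : Type*} (s : ℕ → J) (i n : ℕ) : List J :=
  (List.range' i n).map s

variable {J : Type*}

theorem length_wordFactor (s : ℕ → J) (i n : ℕ) : (wordFactor s i n).length = n := by
  simp [wordFactor]

theorem wordFactor_add (s : ℕ → J) (i m n : ℕ) :
    wordFactor s i (m + n) = wordFactor s i m ++ wordFactor s (i + m) n := by
  simp [wordFactor, ← List.map_append]

theorem wordFactor_one (s : ℕ → J) (i : ℕ) : wordFactor s i 1 = [s i] := rfl

theorem take_wordFactor_add (s : ℕ → J) (i m n : ℕ) :
    (wordFactor s i (m + n)).take m = wordFactor s i m := by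
  rw [wordFactor_add]
  exact List.take_left' (length_wordFactor s i m)

/-- A factor-closed language over a finite alphabet that is infinite contains all factors of some
infinite word. -/
theorem exists_wordFactor_mem_of_infinite [Finite J] {I : Set (List J)} (hI : I.Infinite)
    (hfac : ∀ l l' : List J, l <:+: l' → l' ∈ I → l ∈ I) :
    ∃ s : ℕ → J, ∀ i n, wordFactor s i n ∈ I := by
  let α : ℕ → Type _ := fun i => {l : List J // l ∈ I ∧ l.length = i}
  have hfin : ∀ i, Finite (α i) := fun i =>
    Set.Finite.subset (List.finite_length_eq J i) fun _ h => h.2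
  have hne : ∀ i, Nonempty (α i) := fun i => by
    have : ¬ I ⊆ {l | l.length < i} := fun h => hI ((List.finite_length_lt J i).subset h)
    obtain ⟨l, hl, hli⟩ := Set.not_subset.1 this
    exact ⟨l.take i, hfac _ _ (List.take_prefix i l).isInfix hl, by
      simp only [Set.mem_ofPred_eq, not_lt] at hli
      simp [hli]⟩
  -- König's lemma: an inverse limit of finite nonempty sets, with truncation as transition map, has
  -- a point.
  obtain ⟨f, hf⟩ := exists_seq_forall_proj_of_forall_finite (α := α)
    (fun {i j} hij a => ⟨a.1.take i, hfac _ _ (List.take_prefix i a.1).isInfix a.2.1, by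
      simp [a.2.2, hij]⟩)
    (fun i a => Subtype.ext (List.take_of_length_le a.2.2.le))
    (fun i j l hij hjl a => Subtype.ext (by simp [List.take_take, hij]))
    (fun i a => Set.toFinite _)
  have hf' : ∀ i j, i ≤ j → (f j).1.take i = (f i).1 := fun i j hij => congrArg Subtype.val (hf hij)
  have hs : ∀ i, ∃ y, (f (i + 1)).1[i]? = some y := fun i =>
    ⟨_, List.getElem?_eq_getElem (by rw [(f (i + 1)).2.2]; exact i.lt_succ_self)⟩
  choose s hs using hs
  have hpre : ∀ n, wordFactor s 0 n = (f n).1 := fun n => by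
    apply List.ext_getElem?
    intro i
    rcases lt_or_ge i n with hi | hi
    · have h1 := hs i
      rw [← hf' (i + 1) n hi, List.getElem?_take_of_lt i.lt_succ_self] at h1
      rw [h1]
      simp [wordFactor, hi]
    · rw [List.getElem?_eq_none (by rwa [length_wordFactor]),
        List.getElem?_eq_none (by rwa [(f n).2.2])]
  refine ⟨s, fun i n => ?_⟩
  refine hfac _ _ ?_ (f (i + n)).2.1
  rw [← hpre, wordFactor_add, zero_add]
  exact (List.suffix_append _ _).isInfix

/-- The Morse-Hedlund theorem: an infinite word with at most `m` factors of length `m` is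
eventually periodic. -/
theorem exists_eventually_periodic_of_ncard_wordFactor_le [Finite J] (s : ℕ → J) (m : ℕ)
    (hm : (Set.range fun i => wordFactor s i m).ncard ≤ m) :
    ∃ a q, 0 < q ∧ ∀ i, s (a + i + q) = s (a + i) := by
  let c : ℕ → Set (List J) := fun j => Set.range fun i => wordFactor s i j
  have hfin : ∀ j, (c j).Finite := fun j =>
    (List.finite_length_eq J j).subset (by rintro _ ⟨i, rfl⟩; exact length_wordFactor s i j)
  have himage : ∀ j, List.take j '' c (j + 1) = c j := fun j => by
    simp only [c, ← Set.range_comp, Function.comp_def, take_wordFactor_add]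
  -- There is one factor of length zero, so strict growth at every length would give at least `m +
  -- 1` factors of length `m`.
  obtain ⟨j, hj⟩ : ∃ j, (c (j + 1)).ncard ≤ (c j).ncard := by
    by_contra! hcon
    have : ∀ j, j + 1 ≤ (c j).ncard := fun j => by
      induction j with
      | zero =>
        have : c 0 = {[]} := by simp [c, wordFactor]
        simp [this]
      | succ j ih => exact ih.trans_lt (hcon j)
    exact absurd hm (not_le.2 (this m))
  -- Truncation is onto between sets of equal finite size, hence injective: each factor of length
  -- `j` determines the next letter.
  have hinj : Set.InjOn (List.take j) (c (j + 1)) := by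
    apply Set.injOn_of_ncard_image_eq _ (hfin _)
    rw [himage]
    refine le_antisymm ?_ hj
    rw [← himage]
    exact Set.ncard_image_le (hfin _)
  have hext : ∀ i i', wordFactor s i j = wordFactor s i' j →
      s (i + j) = s (i' + j) ∧ wordFactor s (i + 1) j = wordFactor s (i' + 1) j := by
    intro i i' h
    have h1 : wordFactor s i (j + 1) = wordFactor s i' (j + 1) :=
      hinj ⟨i, rfl⟩ ⟨i', rfl⟩ (by simpa only [take_wordFactor_add] using h)
    constructor
    · rw [wordFactor_add, wordFactor_add, h, wordFactor_one, wordFactor_one] at h1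
      simpa using h1
    · rw [add_comm j 1, wordFactor_add, wordFactor_add, wordFactor_one, wordFactor_one] at h1
      exact (List.cons.inj h1).2
  have hpigeon : ∃ i i', i < i' ∧ wordFactor s i j = wordFactor s i' j := by
    have : Finite (c j) := hfin j
    obtain ⟨i, i', hne, h⟩ := Finite.exists_ne_map_eq_of_infinite
      (fun i : ℕ => (⟨wordFactor s i j, i, rfl⟩ : c j))
    have h := congrArg Subtype.val h
    rcases hne.lt_or_gt with hlt | hlt
    · exact ⟨i, i', hlt, h⟩
    · exact ⟨i', i, hlt, h.symm⟩
  obtain ⟨i, i', hlt, h⟩ := hpigeon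
  have hall : ∀ t, wordFactor s (i + t) j = wordFactor s (i' + t) j := fun t => by
    induction t with
    | zero => exact h
    | succ t ih => exact (hext _ _ ih).2
  refine ⟨i + j, i' - i, by omega, fun t => ?_⟩
  have := (hext _ _ (hall t)).1
  rw [show i + j + t + (i' - i) = i' + t + j by omega, show i + j + t = i + t + j by omega, this]

theorem wordFactor_mul_of_periodic {s : ℕ → J} {a q : ℕ} (h : ∀ i, s (a + i + q) = s (a + i))
    (n : ℕ) : wordFactor s a (q * n) = (List.replicate n (wordFactor s a q)).flatten := by
  have hshift : ∀ n, wordFactor s (a + q) n = wordFactor s a n := fun n => by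
    induction n with
    | zero => rfl
    | succ n ih =>
      rw [wordFactor_add, wordFactor_add, ih, wordFactor_one, wordFactor_one,
        show a + q + n = a + n + q by omega, h]
  induction n with
  | zero => rfl
  | succ n ih =>
    rw [mul_add, mul_one, add_comm, wordFactor_add, hshift, ih, List.replicate_succ,
      List.flatten_cons]

end InfiniteWords

/-! ### Reducible words and a basis of irreducible ones. -/

section ReducibleWords

/-- The value of a word read from right to left. -/
def evalRev {J D : Type*} [Monoid D] (v : J → D) (l : List J) : D :=
  (l.map v).reverse.prod

section Monoid

variable {J D : Type*} [Monoid D] (v : J → D)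

theorem evalRev_append (l l' : List J) : evalRev v (l ++ l') = evalRev v l' * evalRev v l := by
  simp [evalRev]

theorem evalRev_nil : evalRev v [] = 1 := rfl

theorem evalRev_singleton (j : J) : evalRev v [j] = v j := by
  simp [evalRev]

theorem evalRev_cons (j : J) (l : List J) : evalRev v (j :: l) = evalRev v l * v j := by
  simp [evalRev]

theorem evalRev_flatten_replicate (l : List J) (n : ℕ) :
    evalRev v (List.replicate n l).flatten = evalRev v l ^ n := by
  induction n with
  | zero => simp [evalRev]
  | succ n ih => rw [List.replicate_succ, List.flatten_cons, evalRev_append, ih, pow_succ]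

end Monoid

theorem List.Shortlex.append_append {α : Type*} {r : α → α → Prop} {l l' t t' : List α}
    (h : List.Shortlex r l l') (ht : t.length = t'.length) :
    List.Shortlex r (l ++ t) (l' ++ t') := by
  rcases List.shortlex_def.1 h with h | ⟨hlen, hlex⟩
  · exact .of_length_lt (by simpa [ht] using h)
  · refine .of_lex (by simp [ht, hlen]) ?_
    clear h
    induction hlex with
    | nil => simp at hlen
    | cons _ ih => exact .cons (ih (by simpa using hlen))
    | rel h => exact .rel h

variable {J D : Type*} [LinearOrder J] [DivisionRing D] (K : Subfield D) (v : J → D)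

/-- A word is reducible if its value is a left linear combination of values of words that are
smaller in the shortlex order. -/
def IsReducibleWord (l : List J) : Prop :=
  evalRev v l ∈ Submodule.span K (evalRev v '' {l' | List.Shortlex (· < ·) l' l})

variable {K v}

theorem IsReducibleWord.cons {l : List J} (h : IsReducibleWord K v l) (j : J) :
    IsReducibleWord K v (j :: l) := by
  have h1 := Submodule.mem_map_of_mem (f := LinearMap.mulRight K (v j)) h
  rw [Submodule.map_span] at h1
  rw [IsReducibleWord, evalRev_cons]
  refine Submodule.span_mono ?_ h1
  rintro _ ⟨_, ⟨l', hl', rfl⟩, rfl⟩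
  exact ⟨j :: l', hl'.cons, evalRev_cons v j l'⟩

/-- Appending `j` multiplies the value by `v j` on the left. Moving a letter past a coefficient in
`K` may change that letter arbitrarily. This is harmless since it comes last in the word and
shortlex has already decided on the prefixes; this is why values are read from right to left. -/
theorem IsReducibleWord.append_singleton
    (hv : ∀ j, ∀ f ∈ K, v j * f ∈ Submodule.span K (Set.range v)) {l : List J}
    (h : IsReducibleWord K v l) (j : J) : IsReducibleWord K v (l ++ [j]) := by
  set T := Submodule.span K (evalRev v '' {l' | List.Shortlex (· < ·) l' (l ++ [j])}) with hT
  have key : ∀ u ∈ Submodule.span K (evalRev v '' {l' | List.Shortlex (· < ·) l' l}),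
      ∀ i, v i * u ∈ T := by
    intro u hu
    induction hu using Submodule.span_induction with
    | mem u hu =>
      obtain ⟨l', hl', rfl⟩ := hu
      intro i
      rw [← evalRev_singleton v i, ← evalRev_append]
      exact Submodule.subset_span ⟨l' ++ [i], hl'.append_append (t := [i]) (t' := [j]) rfl, rfl⟩
    | zero => simp
    | add x y _ _ hx hy =>
      intro i
      rw [mul_add]
      exact add_mem (hx i) (hy i)
    | smul f u _ hu =>
      intro i
      have h1 : ∀ c ∈ Submodule.span K (Set.range v), c * u ∈ T := by
        intro c hc
        induction hc using Submodule.span_induction with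
        | mem c hc => obtain ⟨i, rfl⟩ := hc; exact hu i
        | zero => simp
        | add x y _ _ hx hy => rw [add_mul]; exact add_mem hx hy
        | smul f c _ hc => rw [smul_mul_assoc]; exact T.smul_mem f hc
      rw [Subfield.smul_def, smul_eq_mul, ← mul_assoc]
      exact h1 _ (hv i f f.2)
  rw [IsReducibleWord, evalRev_append, evalRev_singleton]
  exact key _ h j

theorem IsReducibleWord.of_infix
    (hv : ∀ j, ∀ f ∈ K, v j * f ∈ Submodule.span K (Set.range v)) {l l' : List J}
    (hl : l <:+: l') (h : IsReducibleWord K v l) : IsReducibleWord K v l' := by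
  obtain ⟨s, t, rfl⟩ := hl
  have h1 : IsReducibleWord K v (l ++ t) := by
    induction t using List.reverseRecOn with
    | nil => simpa using h
    | append_singleton t j ih => rw [← List.append_assoc]; exact ih.append_singleton hv j
  rw [List.append_assoc]
  induction s with
  | nil => exact h1
  | cons j s ih => exact ih.cons j

variable (K v) in
theorem evalRev_mem_span_irreducible [Finite J] (l : List J) :
    evalRev v l ∈ Submodule.span K (evalRev v '' {l | ¬ IsReducibleWord K v l}) := by
  induction l using (List.Shortlex.wf (r := ((· < ·) : J → J → Prop)) wellFounded_lt).induction with
  | _ l ih =>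
  by_cases hl : IsReducibleWord K v l
  · refine Submodule.span_le.2 ?_ hl
    rintro _ ⟨l', hl', rfl⟩
    exact ih l' hl'
  · exact Submodule.subset_span ⟨l, hl, rfl⟩

variable (K v) in
-- In a nontrivial relation, solving for the largest word would make it reducible.
theorem linearIndepOn_evalRev_irreducible :
    LinearIndepOn K (evalRev v) {l | ¬ IsReducibleWord K v l} := by
  rw [linearIndepOn_iff]
  intro c hc h0
  by_contra hne
  have hmax : ∃ l ∈ c.support, ∀ l' ∈ c.support, l' ≠ l → List.Shortlex (· < ·) l' l := by
    obtain ⟨l, hl, hmax⟩ := c.support.exists_max_image (fun l => toLex (l.length, l))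
      (Finsupp.support_nonempty_iff.2 hne)
    refine ⟨l, hl, fun l' hl' hne' => ?_⟩
    have h1 : toLex (l'.length, l') < toLex (l.length, l) :=
      lt_of_le_of_ne (hmax l' hl') fun h => hne' (congrArg Prod.snd (toLex.injective h))
    exact List.shortlex_def.2 (Prod.Lex.lt_iff.1 h1)
  obtain ⟨l, hl, hmax⟩ := hmax
  refine hc hl ?_
  rw [Finsupp.linearCombination_apply, Finsupp.sum, ← Finset.add_sum_erase _ _ hl] at h0
  have h1 : evalRev v l = -((c l)⁻¹ • ∑ i ∈ c.support.erase l, c i • evalRev v i) := by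
    rw [eq_neg_iff_add_eq_zero, ← inv_smul_smul₀ (Finsupp.mem_support_iff.1 hl) (evalRev v l),
      ← smul_add, h0, smul_zero]
  rw [IsReducibleWord, h1]
  refine neg_mem (Submodule.smul_mem _ _ (Submodule.sum_mem _ fun i hi => ?_))
  exact Submodule.smul_mem _ _ (Submodule.subset_span ⟨i,
    hmax i (Finset.mem_of_mem_erase hi) (Finset.ne_of_mem_erase hi), rfl⟩)

/-- Lower powers of `evalRev v l` are values of shorter words, as `l` is nonempty. -/
theorem exists_isReducibleWord_flatten_replicate {l : List J} (hl : l ≠ [])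
    (halg : ∃ n, evalRev v l ^ n ∈ Submodule.span K ((fun i => evalRev v l ^ i) '' Set.Iio n)) :
    ∃ n, IsReducibleWord K v (List.replicate n l).flatten := by
  obtain ⟨n, hn⟩ := halg
  refine ⟨n, ?_⟩
  rw [IsReducibleWord, evalRev_flatten_replicate]
  refine Submodule.span_mono ?_ hn
  rintro _ ⟨i, hi, rfl⟩
  refine ⟨(List.replicate i l).flatten, .of_length_lt ?_, evalRev_flatten_replicate v l i⟩
  simpa [List.length_pos_iff.2 hl] using hi

theorem add_one_le_ncard_irreducible_of_infinite [Finite J]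
    (hv : ∀ j, ∀ f ∈ K, v j * f ∈ Submodule.span K (Set.range v))
    (halg : ∀ b : D, ∃ n, b ^ n ∈ Submodule.span K ((fun i => b ^ i) '' Set.Iio n))
    (hinf : {l | ¬ IsReducibleWord K v l}.Infinite) (m : ℕ) :
    m + 1 ≤ {l | ¬ IsReducibleWord K v l ∧ l.length = m}.ncard := by
  by_contra! hm
  obtain ⟨s, hs⟩ := exists_wordFactor_mem_of_infinite hinf fun l l' hl hl' h =>
    hl' (h.of_infix hv hl)
  obtain ⟨a, q, hq, hper⟩ := exists_eventually_periodic_of_ncard_wordFactor_le s m <|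
    (Set.ncard_le_ncard (by
      rintro _ ⟨i, rfl⟩
      exact ⟨hs i m, length_wordFactor s i m⟩)
      ((List.finite_length_eq J m).subset fun l hl => hl.2)).trans (Nat.le_of_lt_succ hm)
  obtain ⟨n, hn⟩ := exists_isReducibleWord_flatten_replicate (K := K) (v := v)
    (l := wordFactor s a q) (by
      rw [← List.length_pos_iff, length_wordFactor]
      exact hq) (halg _)
  rw [← wordFactor_mul_of_periodic hper] at hn
  exact hs _ _ hn

end ReducibleWords

/-! ### Quadratically many irreducible words force cubic growth. -/

section QuadraticGrowth

/-- Independence in the tower `k`, `K`, `D`: the powers of `y` are independent over `k` inside `K`,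
the `w` over `K`. -/
theorem linearIndependent_pow_mul_of_transcendental {k D : Type*} [Field k] [DivisionRing D]
    [Algebra k D] {K : Subfield D} (hk : ∀ c : k, algebraMap k D c ∈ K) {y : D} (hyK : y ∈ K)
    (hy : Transcendental k y) {κ : Type*} {w : κ → D} (hw : LinearIndependent K w) :
    LinearIndependent k fun p : ℕ × κ => y ^ p.1 * w p.2 := by
  let _ : Module k K := Module.compHom K ((algebraMap k D).codRestrict K hk)
  have hsmul : ∀ (c : k) (f : K), ((c • f : K) : D) = c • (f : D) := fun c f =>
    (Algebra.smul_def c (f : D)).symm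
  have : IsScalarTower k K D := ⟨fun c f d => by
    rw [Subfield.smul_def, Subfield.smul_def, hsmul, smul_assoc]⟩
  have hpow : LinearIndependent k fun i : ℕ => y ^ i := by
    have h := (Polynomial.basisMonomials k).linearIndependent.map'
      (Polynomial.aeval y).toLinearMap
      (LinearMap.ker_eq_bot.2 (transcendental_iff_injective.1 hy))
    have hfun : (Polynomial.aeval y).toLinearMap ∘ Polynomial.basisMonomials k =
        fun i : ℕ => y ^ i := by
      ext i
      simp
    rwa [hfun] at h
  have hpowK : LinearIndependent k fun i : ℕ => (⟨y, hyK⟩ : K) ^ i := by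
    let f : K →ₗ[k] D :=
      { toFun := Subtype.val
        map_add' := fun _ _ => rfl
        map_smul' := hsmul }
    exact LinearIndependent.of_comp f hpow
  exact linearIndependent_smul hpowK hw


theorem two_mul_ncard_irreducible_length_le {J : Type*} [LinearOrder J] [Finite J] {D : Type*} [DivisionRing D]
    {K : Subfield D} {v : J → D}
    (h : ∀ m, m + 1 ≤ {l | ¬ IsReducibleWord K v l ∧ l.length = m}.ncard) (n : ℕ) :
    (n + 1) * (n + 2) ≤ 2 * {l | ¬ IsReducibleWord K v l ∧ l.length ≤ n}.ncard := by
  induction n with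
  | zero => simpa using h 0
  | succ n ih =>
    have hunion : {l | ¬ IsReducibleWord K v l ∧ l.length ≤ n + 1} =
        {l | ¬ IsReducibleWord K v l ∧ l.length ≤ n} ∪
          {l | ¬ IsReducibleWord K v l ∧ l.length = n + 1} := by
      ext l
      simp only [Set.mem_ofPred_eq, Set.mem_union, Nat.le_add_one_iff, and_or_left]
    rw [hunion, Set.ncard_union_eq ?_ ((List.finite_length_le J n).subset fun l hl => hl.2)
      ((List.finite_length_eq J (n + 1)).subset fun l hl => hl.2)]
    · have := h (n + 1)
      nlinarith
    · rw [Set.disjoint_left]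
      rintro l ⟨-, hl⟩ ⟨-, hl'⟩
      omega

variable {k : Type u} {A : Type v} [Field k] [Ring A] [Algebra k A]

theorem evalRev_mem_pow {J : Type*} {V : Submodule k A} (h1 : (1 : A) ∈ V) {v : J → A} (hv : ∀ j, v j ∈ V)
    {l : List J} {n : ℕ} (hl : l.length ≤ n) : evalRev v l ∈ V ^ n := by
  have hmono : V ^ l.length ≤ V ^ n := pow_le_pow_right₀ (Submodule.one_le.2 h1) hl
  apply hmono
  clear hmono hl
  induction l with
  | nil => exact Submodule.one_le.1 le_rfl
  | cons j l ih =>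
    rw [evalRev_cons, List.length_cons, pow_succ]
    exact Submodule.mul_mem_mul ih (hv j)

theorem map_evalRev {J B : Type*} [Ring B] (f : A →+* B) (v : J → A) (l : List J) :
    evalRev (fun j => f (v j)) l = f (evalRev v l) := by
  induction l with
  | nil => simp [evalRev_nil]
  | cons j l ih => rw [evalRev_cons, evalRev_cons, map_mul, ih]

theorem le_finrank_pow_of_le_ncard_irreducible {J : Type*} [LinearOrder J] [Finite J] {D : Type w} [DivisionRing D] [Algebra k D]
    (ι : A →ₐ[k] D) (hι : Function.Injective ι) {K : Subfield D}
    (hk : ∀ c : k, algebraMap k D c ∈ K) {x : A} (hx : Transcendental k x) (hxK : ι x ∈ K)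
    {v : J → A}
    (h : ∀ m, m + 1 ≤ {l | ¬ IsReducibleWord K (fun j => ι (v j)) l ∧ l.length = m}.ncard)
    {V : Submodule k A} [hV : Module.Finite k V] (h1 : (1 : A) ∈ V) (hxV : x ∈ V)
    (hv : ∀ j, v j ∈ V) (n : ℕ) :
    (n + 1) * ((n + 1) * (n + 2)) ≤ 2 * Module.finrank k (V ^ (n + n) : Submodule k A) := by
  set S := {l | ¬ IsReducibleWord K (fun j => ι (v j)) l ∧ l.length ≤ n} with hS
  have hSfin : Finite S := (List.finite_length_le J n).subset fun l hl => hl.2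
  have := Fintype.ofFinite S
  have hind : LinearIndependent k fun p : ℕ × S => x ^ p.1 * evalRev v p.2 := by
    have hw : LinearIndependent K fun l : S => evalRev (fun j => ι (v j)) l :=
      (linearIndepOn_evalRev_irreducible K _).mono fun l hl => hl.1
    refine LinearIndependent.of_comp ι.toLinearMap ?_
    convert linearIndependent_pow_mul_of_transcendental hk hxK
      (mt (isAlgebraic_algHom_iff ι hι).1 hx) hw with p
    have := map_evalRev (ι : A →+* D) v p.2
    simp only [Function.comp_apply, AlgHom.toLinearMap_apply, map_mul, map_pow]
    congr 1
    exact this.symm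
  have hind' : LinearIndependent k fun p : Fin (n + 1) × S => x ^ (p.1 : ℕ) * evalRev v p.2 :=
    hind.comp (fun p : Fin (n + 1) × S => ((p.1 : ℕ), p.2))
      (Function.Injective.prodMap Fin.val_injective Function.injective_id)
  have hfin : Module.Finite k (V ^ (n + n) : Submodule k A) :=
    Module.Finite.iff_fg.2 ((Module.Finite.iff_fg.1 hV).pow _)
  have hle : Submodule.span k (Set.range fun p : Fin (n + 1) × S => x ^ (p.1 : ℕ) * evalRev v p.2)
      ≤ V ^ (n + n) := by
    rw [Submodule.span_le]
    rintro _ ⟨p, rfl⟩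
    rw [pow_add]
    refine Submodule.mul_mem_mul ?_ (evalRev_mem_pow h1 hv p.2.2.2)
    exact pow_le_pow_right₀ (Submodule.one_le.2 h1) (Nat.lt_succ_iff.1 p.1.2)
      (Submodule.pow_mem_pow V hxV _)
  have hcard := Submodule.finrank_mono hle
  rw [finrank_span_eq_card hind', Fintype.card_prod, Fintype.card_fin, ← Nat.card_eq_fintype_card,
    Nat.card_coe_set_eq] at hcard
  have := two_mul_ncard_irreducible_length_le h n
  calc (n + 1) * ((n + 1) * (n + 2)) ≤ (n + 1) * (2 * S.ncard) := by gcongr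
    _ = 2 * ((n + 1) * S.ncard) := by ring
    _ ≤ _ := by gcongr

theorem three_le_gkDim_of_cubic_growth {V : Submodule k A} [hV : Module.Finite k V]
    (h1 : (1 : A) ∈ V)
    (h : ∀ n, (n + 1) * ((n + 1) * (n + 2)) ≤
      2 * Module.finrank k (V ^ (n + n) : Submodule k A)) : 3 ≤ gkDim k A := by
  by_contra! hGK
  obtain ⟨c, hc, hev⟩ := exists_finrank_pow_le_rpow_of_gkDim_lt hGK V h1
  have hlim := (tendsto_rpow_atTop (sub_pos.2 hc)).comp
    (tendsto_natCast_atTop_atTop (R := ℝ))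
  have hdouble : Filter.Tendsto (fun n : ℕ => n + n) Filter.atTop Filter.atTop :=
    Filter.tendsto_atTop_mono (fun n => Nat.le_add_left n n) Filter.tendsto_id
  -- The threshold 16 turns `(2n) ^ c` into less than `(2n) ^ 3 / 16 = n ^ 3 / 2`, whereas the
  -- dimension is at least `(n + 1) ^ 2 * (n + 2) / 2`.
  obtain ⟨n, ⟨hn1, hn2⟩, hn3⟩ := ((hdouble.eventually
    (hev.and (hlim.eventually_gt_atTop 16))).and (Filter.eventually_ge_atTop 1)).exists
  have hpos : (0 : ℝ) < ((n + n : ℕ) : ℝ) := by exact_mod_cast (by omega : 0 < n + n)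
  have hcub : ((n : ℝ) + 1) * (((n : ℝ) + 1) * (n + 2)) ≤
      2 * Module.finrank k (V ^ (n + n) : Submodule k A) := by exact_mod_cast h n
  have hsplit : ((n + n : ℕ) : ℝ) ^ (3 : ℝ) =
      ((n + n : ℕ) : ℝ) ^ (3 - c) * ((n + n : ℕ) : ℝ) ^ c := by
    rw [← Real.rpow_add hpos, sub_add_cancel]
  have h3 : ((n + n : ℕ) : ℝ) ^ (3 : ℝ) = 8 * (n : ℝ) ^ 3 := by
    rw [show (3 : ℝ) = ((3 : ℕ) : ℝ) by norm_num, Real.rpow_natCast]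
    push_cast
    ring
  have hcpos : 0 < ((n + n : ℕ) : ℝ) ^ c := Real.rpow_pos_of_pos hpos c
  have h4 : 16 * ((n + n : ℕ) : ℝ) ^ c < 8 * (n : ℝ) ^ 3 := by
    rw [← h3, hsplit]
    exact mul_lt_mul_of_pos_right hn2 hcpos
  have hn0 : (0 : ℝ) ≤ n := n.cast_nonneg
  nlinarith [mul_nonneg hn0 hn0]

end QuadraticGrowth

/-! ### From left algebraicity to a faithful matrix representation. -/

section LeftAlgebraic

variable {k : Type u} {D : Type w} [Field k] [DivisionRing D] [Algebra k D]

theorem algebraMap_mem_adjoinSimple (y : D) (c : k) : algebraMap k D c ∈ adjoinSimple k y :=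
  Subfield.subset_closure (Or.inl ⟨c, rfl⟩)

theorem mem_adjoinSimple_self (y : D) : y ∈ adjoinSimple k y :=
  Subfield.subset_closure (Or.inr rfl)

theorem commute_of_mem_adjoinSimple_of_commute {y b : D} (hb : Commute y b) {a : D}
    (ha : a ∈ adjoinSimple k y) : Commute a b := by
  induction ha using Subfield.closure_induction with
  | mem a ha =>
    rcases ha with ⟨c, rfl⟩ | rfl
    · exact Algebra.commutes c b
    · exact hb
  | one => exact Commute.one_left b
  | add _ _ _ _ h h' => exact h.add_left h'
  | neg _ _ h => exact h.neg_left
  | inv _ _ h => exact h.inv_left₀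
  | mul _ _ _ _ h h' => exact h.mul_left h'

theorem commute_of_mem_adjoinSimple {y a b : D} (ha : a ∈ adjoinSimple k y)
    (hb : b ∈ adjoinSimple k y) : Commute a b :=
  commute_of_mem_adjoinSimple_of_commute
    (commute_of_mem_adjoinSimple_of_commute (Commute.refl y) hb).symm ha

theorem IsLeftAlgebraicElem.exists_pow_mem_span {K : Subfield D} {b : D}
    (h : IsLeftAlgebraicElem K b) :
    ∃ n, b ^ n ∈ Submodule.span K ((fun i => b ^ i) '' Set.Iio n) := by
  obtain ⟨e, he, h0⟩ := h
  obtain ⟨n, hn, hmax⟩ := e.support.exists_max_image id (Finsupp.support_nonempty_iff.2 he)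
  refine ⟨n, ?_⟩
  rw [Finsupp.sum, ← Finset.add_sum_erase _ _ hn] at h0
  have h0' : e n • b ^ n + ∑ i ∈ e.support.erase n, e i • b ^ i = 0 := h0
  have h1 : b ^ n = -((e n)⁻¹ • ∑ i ∈ e.support.erase n, e i • b ^ i) := by
    rw [eq_neg_iff_add_eq_zero, ← inv_smul_smul₀ (Finsupp.mem_support_iff.1 hn) (b ^ n),
      ← smul_add, h0', smul_zero]
  rw [h1]
  refine neg_mem (Submodule.smul_mem _ _ (Submodule.sum_mem _ fun i hi => ?_))
  exact Submodule.smul_mem _ _ (Submodule.subset_span ⟨i,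
    lt_of_le_of_ne (hmax i (Finset.mem_of_mem_erase hi)) (Finset.ne_of_mem_erase hi), rfl⟩)

/-- If `D` is left algebraic over `K`, then every `u * K[y]` has finite left dimension over `K`:
apply algebraicity to the conjugate `u * y * u⁻¹`. -/
theorem IsLeftAlgebraicOver.exists_mul_pow_mem_span {K : Subfield D} (h : IsLeftAlgebraicOver K)
    (u y : D) : ∃ n, u * y ^ n ∈ Submodule.span K ((fun i => u * y ^ i) '' Set.Iio n) := by
  by_cases hu : u = 0
  · exact ⟨0, by simp [hu]⟩
  obtain ⟨n, hn⟩ := (h (u * y * u⁻¹)).exists_pow_mem_span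
  have hpow : ∀ i, (u * y * u⁻¹) ^ i * u = u * y ^ i := fun i => by
    induction i with
    | zero => simp
    | succ i ih => rw [pow_succ, mul_assoc, inv_mul_cancel_right₀ hu, ← mul_assoc, ih, mul_assoc,
        ← pow_succ]
  refine ⟨n, ?_⟩
  have h1 := Submodule.mem_map_of_mem (f := LinearMap.mulRight K u) hn
  rw [Submodule.map_span, LinearMap.mulRight_apply, hpow, ← Set.image_comp] at h1
  simpa only [Function.comp_def, LinearMap.mulRight_apply, hpow] using h1

theorem mul_mem_of_forall_mul_mem_of_mem_adjoinSimple {y : D}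
    {W : Submodule (adjoinSimple k y) D} [Module.Finite (adjoinSimple k y) W]
    (hW : ∀ w ∈ W, w * y ∈ W) {f : D} (hf : f ∈ adjoinSimple k y) : ∀ w ∈ W, w * f ∈ W := by
  induction hf using Subfield.closure_induction with
  | mem a ha =>
    rcases ha with ⟨c, rfl⟩ | rfl
    · intro w hw
      rw [← Algebra.commutes]
      exact W.smul_mem ⟨_, algebraMap_mem_adjoinSimple y c⟩ hw
    · exact hW
  | one => simp
  | add _ _ _ _ h h' => intro w hw; rw [mul_add]; exact add_mem (h w hw) (h' w hw)
  | neg _ _ h => intro w hw; rw [mul_neg]; exact neg_mem (h w hw)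
  | mul _ _ _ _ h h' => intro w hw; rw [← mul_assoc]; exact h' _ (h w hw)
  | inv a _ h =>
    intro w hw
    by_cases ha : a = 0
    · simp [ha]
    -- An injective endomorphism of a finite-dimensional space is onto, so right division by `a`
    -- preserves `W`.
    let f : W →ₗ[adjoinSimple k y] W := (LinearMap.mulRight (adjoinSimple k y) a).restrict h
    have hf : Function.Injective f := fun p q hpq =>
      Subtype.ext (mul_right_cancel₀ ha (congrArg Subtype.val hpq))
    obtain ⟨p, hp⟩ := LinearMap.injective_iff_surjective.1 hf ⟨w, hw⟩
    have hp' : (p : D) * a = w := congrArg Subtype.val hp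
    rw [← hp', mul_inv_cancel_right₀ ha]
    exact p.2

variable {A : Type v} [Ring A] [Algebra k A]

/-- The letters are `g * x ^ i` with `g` a generator and `i < n g`, where `g * x ^ n g` depends on
the earlier ones. Their span is stable under `x`, hence under all of `k(x)`. -/
theorem exists_letters_of_isLeftAlgebraicOver (hfg : Algebra.FiniteType k A) (ι : A →ₐ[k] D)
    (hι : Function.Injective ι) (x : A) (halg : IsLeftAlgebraicOver (adjoinSimple k (ι x))) :
    ∃ (r : ℕ) (v : Fin r → A), Algebra.adjoin k (Set.range v) = ⊤ ∧
      ∀ j, ∀ f ∈ adjoinSimple k (ι x), ι (v j) * f ∈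
        Submodule.span (adjoinSimple k (ι x)) (Set.range fun j => ι (v j)) := by
  obtain ⟨G, hG⟩ := hfg.out
  choose n hn using fun g : G => halg.exists_mul_pow_mem_span (ι g) (ι x)
  let v₀ : (Σ g : G, Fin (n g)) → A := fun p => (p.1 : A) * x ^ (p.2 : ℕ)
  let e := Fintype.equivFin (Σ g : G, Fin (n g))
  have hrange : Set.range (v₀ ∘ e.symm) = Set.range v₀ := e.symm.surjective.range_comp v₀
  have hrange' : (Set.range fun j => ι ((v₀ ∘ e.symm) j)) = Set.range fun p => ι (v₀ p) :=
    e.symm.surjective.range_comp fun p => ι (v₀ p)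
  refine ⟨_, v₀ ∘ e.symm, ?_, fun j f hf => ?_⟩
  · rw [hrange, eq_top_iff, ← hG, Algebra.adjoin_le_iff]
    intro g hg
    -- If `n g = 0` the generator contributes no letter, but then it is zero.
    rcases Nat.eq_zero_or_pos (n ⟨g, hg⟩) with h0 | hpos
    · have h1 := hn ⟨g, hg⟩
      rw [h0] at h1
      have h2 : g = 0 := by simpa [map_eq_zero_iff ι hι] using h1
      rw [h2]
      exact zero_mem _
    · exact Algebra.subset_adjoin ⟨⟨⟨g, hg⟩, ⟨0, hpos⟩⟩, by simp [v₀]⟩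
  · rw [hrange']
    have hfin : Module.Finite (adjoinSimple k (ι x))
        (Submodule.span (adjoinSimple k (ι x)) (Set.range fun p => ι (v₀ p))) :=
      Module.Finite.span_of_finite _ (Set.finite_range _)
    refine mul_mem_of_forall_mul_mem_of_mem_adjoinSimple ?_ hf _
      (Submodule.subset_span ⟨e.symm j, rfl⟩)
    intro w hw
    have h1 := Submodule.mem_map_of_mem (f := LinearMap.mulRight (adjoinSimple k (ι x)) (ι x)) hw
    rw [Submodule.map_span] at h1
    refine Submodule.span_le.2 ?_ h1
    rintro _ ⟨_, ⟨⟨g, i⟩, rfl⟩, rfl⟩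
    have h2 : ι (v₀ ⟨g, i⟩) * ι x = ι g * ι x ^ ((i : ℕ) + 1) := by
      simp [v₀, pow_succ, mul_assoc]
    rw [LinearMap.mulRight_apply, h2]
    have h3 : ∀ i < n g, ι g * ι x ^ i ∈ Set.range fun p => ι (v₀ p) := fun i hi =>
      ⟨⟨g, ⟨i, hi⟩⟩, by simp [v₀]⟩
    rcases Nat.lt_or_ge (i + 1) (n g) with hlt | hge
    · exact Submodule.subset_span (h3 _ hlt)
    · rw [show (i : ℕ) + 1 = n g from le_antisymm i.2 hge]
      refine Submodule.span_mono ?_ (hn g)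
      rintro _ ⟨i, hi, rfl⟩
      exact h3 i hi

theorem finite_end_mulOpposite (F M : Type*) [Field F] [AddCommGroup M] [Module F M]
    [Module.Finite F M] : Module.Finite F (Module.End F M)ᵐᵒᵖ :=
  Module.Finite.equiv (MulOpposite.opLinearEquiv F)

/-- A `k(x)`-subspace of finite left dimension that contains `1` and is stable under right
multiplication by `A` gives a faithful representation of `A` by matrices over `k(x)`. -/
theorem exists_injective_ringHom_of_finite_submodule (ι : A →ₐ[k] D) (hι : Function.Injective ι)
    {y : D} (M : Submodule (adjoinSimple k y) D) [Module.Finite (adjoinSimple k y) M]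
    (h1 : (1 : D) ∈ M) (hM : ∀ a, ∀ m ∈ M, m * ι a ∈ M) :
    ∃ (F : Type w) (_ : Field F) (E : Type w) (_ : Ring E) (_ : Algebra F E)
      (_ : Module.Finite F E) (φ : A →+* E), Function.Injective φ := by
  let _ : Field (adjoinSimple k y) :=
    { (inferInstance : DivisionRing (adjoinSimple k y)) with
      mul_comm := fun a b => Subtype.ext (commute_of_mem_adjoinSimple a.2 b.2) }
  let ρ : A → Module.End (adjoinSimple k y) M := fun a =>
    (LinearMap.mulRight (adjoinSimple k y) (ι a)).restrict (hM a)
  have hρ : ∀ a (m : M), ((ρ a m : M) : D) = m * ι a := fun _ _ => rfl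
  -- Right multiplications compose in reverse order, hence the opposite of the endomorphism ring.
  let φ : A →+* (Module.End (adjoinSimple k y) M)ᵐᵒᵖ :=
    { toFun := fun a => MulOpposite.op (ρ a)
      map_one' := congrArg MulOpposite.op <| LinearMap.ext fun m => Subtype.ext <| by
        rw [hρ, map_one, mul_one, Module.End.one_apply]
      map_zero' := congrArg MulOpposite.op <| LinearMap.ext fun m => Subtype.ext <| by
        rw [hρ, map_zero, mul_zero]; rfl
      map_mul' := fun a b => congrArg MulOpposite.op <| LinearMap.ext fun m => Subtype.ext <| by
        rw [hρ, map_mul, ← mul_assoc]; rfl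
      map_add' := fun a b => congrArg MulOpposite.op <| LinearMap.ext fun m => Subtype.ext <| by
        rw [hρ, map_add, mul_add]; rfl }
  refine ⟨adjoinSimple k y, inferInstance, (Module.End (adjoinSimple k y) M)ᵐᵒᵖ, inferInstance,
    inferInstance, finite_end_mulOpposite (adjoinSimple k y) M, φ, fun a b hab => hι ?_⟩
  have h2 := congrArg (fun f : Module.End (adjoinSimple k y) M => ((f ⟨1, h1⟩ : M) : D))
    (MulOpposite.op_injective hab)
  simpa only [hρ, one_mul] using h2

theorem exists_injective_ringHom_of_isLeftAlgebraicOver (hfg : Algebra.FiniteType k A)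
    (hGK : gkDim k A < 3) (ι : A →ₐ[k] D) (hι : Function.Injective ι) {x : A}
    (hx : Transcendental k x) (halg : IsLeftAlgebraicOver (adjoinSimple k (ι x))) :
    ∃ (F : Type w) (_ : Field F) (E : Type w) (_ : Ring E) (_ : Algebra F E)
      (_ : Module.Finite F E) (φ : A →+* E), Function.Injective φ := by
  obtain ⟨r, v, hgen, hv⟩ := exists_letters_of_isLeftAlgebraicOver hfg ι hι x halg
  set K := adjoinSimple k (ι x) with hK
  have hfin : {l | ¬ IsReducibleWord K (fun j => ι (v j)) l}.Finite := by
    by_contra hinf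
    have hcard := add_one_le_ncard_irreducible_of_infinite hv
      (fun b => (halg b).exists_pow_mem_span) hinf
    let V : Submodule k A := Submodule.span k ({1, x} ∪ Set.range v)
    have hV : Module.Finite k V :=
      Module.Finite.span_of_finite k ((Set.toFinite {1, x}).union (Set.finite_range v))
    have h1 : (1 : A) ∈ V := Submodule.subset_span (by simp)
    refine absurd hGK (not_lt.2 (three_le_gkDim_of_cubic_growth h1 fun n => ?_))
    exact le_finrank_pow_of_le_ncard_irreducible ι hι (algebraMap_mem_adjoinSimple _) hx
      (mem_adjoinSimple_self _) hcard h1 (Submodule.subset_span (by simp))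
      (fun j => Submodule.subset_span (Or.inr ⟨j, rfl⟩)) n
  -- This is `K * A`, spanned by the values of all words; the empty word supplies `1`.
  let M : Submodule K D := Submodule.span K (Set.range (evalRev fun j => ι (v j)))
  have hMfin : Module.Finite K M := by
    have hspan : M = Submodule.span K
        (evalRev (fun j => ι (v j)) '' {l | ¬ IsReducibleWord K (fun j => ι (v j)) l}) := by
      refine le_antisymm (Submodule.span_le.2 ?_) (Submodule.span_mono (Set.image_subset_range _ _))
      rintro _ ⟨l, rfl⟩
      exact evalRev_mem_span_irreducible K _ l
    rw [hspan]
    exact Module.Finite.span_of_finite K (hfin.image _)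
  refine exists_injective_ringHom_of_finite_submodule ι hι M
    (Submodule.subset_span ⟨[], rfl⟩) fun a => ?_
  have ha : a ∈ Algebra.adjoin k (Set.range v) := hgen ▸ Algebra.mem_top
  induction ha using Algebra.adjoin_induction with
  | mem a ha =>
    obtain ⟨j, rfl⟩ := ha
    intro m hm
    have h1 := Submodule.mem_map_of_mem (f := LinearMap.mulRight K (ι (v j))) hm
    rw [Submodule.map_span] at h1
    refine Submodule.span_mono ?_ h1
    rintro _ ⟨_, ⟨l, rfl⟩, rfl⟩
    exact ⟨j :: l, evalRev_cons _ _ _⟩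
  | algebraMap c =>
    intro m hm
    rw [AlgHom.commutes, ← Algebra.commutes]
    exact M.smul_mem ⟨_, algebraMap_mem_adjoinSimple (ι x) c⟩ hm
  | add _ _ _ _ h h' => intro m hm; rw [map_add, mul_add]; exact add_mem (h m hm) (h' m hm)
  | mul _ _ _ _ h h' => intro m hm; rw [map_mul, ← mul_assoc]; exact h' _ (h m hm)

end LeftAlgebraic

/-! ### The right-handed case by opposite algebras. -/

section Opposite

variable {k : Type u} {D : Type w} [Field k] [DivisionRing D] [Algebra k D]

theorem op_mem_adjoinSimple_op {y c : D} (hc : c ∈ adjoinSimple k y) :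
    MulOpposite.op c ∈ adjoinSimple k (MulOpposite.op y) := by
  induction hc using Subfield.closure_induction with
  | mem a ha =>
    rcases ha with ⟨c, rfl⟩ | rfl
    · exact algebraMap_mem_adjoinSimple (k := k) (MulOpposite.op y) c
    · exact mem_adjoinSimple_self _
  | one => exact one_mem _
  | add _ _ _ _ h h' => exact add_mem h h'
  | neg _ _ h => exact neg_mem h
  | inv _ _ h => exact inv_mem h
  | mul _ _ _ _ h h' => exact mul_mem h' h

theorem IsRightAlgebraicOver.op {y : D} (h : IsRightAlgebraicOver (adjoinSimple k y)) :
    IsLeftAlgebraicOver (adjoinSimple k (MulOpposite.op y)) := by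
  intro b
  obtain ⟨e, he, h0⟩ := h b.unop
  let f : adjoinSimple k y → adjoinSimple k (MulOpposite.op y) := fun c =>
    ⟨MulOpposite.op c, op_mem_adjoinSimple_op c.2⟩
  have hf : Function.Injective f := fun c d hcd =>
    Subtype.ext (MulOpposite.op_injective (congrArg Subtype.val hcd))
  have hf0 : f 0 = 0 := rfl
  refine ⟨e.mapRange f hf0, ?_, ?_⟩
  · rw [Ne, ← Finsupp.mapRange_zero (f := f) (hf := hf0), (Finsupp.mapRange_injective f hf0 hf).eq_iff]
    exact he
  · rw [Finsupp.sum_mapRange_index (by simp)]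
    have h1 := congrArg MulOpposite.op h0
    rw [Finsupp.sum, Finset.op_sum] at h1
    simpa [Finsupp.sum, f] using h1

variable {A : Type v} [Ring A] [Algebra k A]

theorem Algebra.FiniteType.mulOpposite (h : Algebra.FiniteType k A) :
    Algebra.FiniteType k Aᵐᵒᵖ := by
  obtain ⟨G, hG⟩ := h.out
  refine ⟨Subalgebra.fg_def.2 ⟨MulOpposite.unop ⁻¹' (G : Set A), ?_, ?_⟩⟩
  · exact G.finite_toSet.preimage MulOpposite.unop_injective.injOn
  · rw [← Subalgebra.op_adjoin, hG, Subalgebra.op_top]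

theorem Transcendental.op {x : A} (h : Transcendental k x) :
    Transcendental k (MulOpposite.op x) := by
  rintro ⟨p, hp, h0⟩
  refine h ⟨p, hp, ?_⟩
  rw [Polynomial.aeval_eq_sum_range] at h0 ⊢
  have h1 := congrArg MulOpposite.unop h0
  simpa using h1

theorem exists_injective_ringHom_of_isRightAlgebraicOver (hfg : Algebra.FiniteType k A)
    (hGK : gkDim k A < 3) (ι : A →ₐ[k] D) (hι : Function.Injective ι) {x : A}
    (hx : Transcendental k x) (halg : IsRightAlgebraicOver (adjoinSimple k (ι x))) :
    ∃ (F : Type w) (_ : Field F) (E : Type w) (_ : Ring E) (_ : Algebra F E)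
      (_ : Module.Finite F E) (φ : A →+* E), Function.Injective φ := by
  obtain ⟨F, _, E, _, _, _, φ, hφ⟩ := exists_injective_ringHom_of_isLeftAlgebraicOver
    hfg.mulOpposite (gkDim_mulOpposite_le.trans_lt hGK) (AlgHom.op ι)
    (MulOpposite.op_injective.comp (hι.comp MulOpposite.unop_injective)) hx.op halg.op
  refine ⟨F, inferInstance, Eᵐᵒᵖ, inferInstance, inferInstance, inferInstance,
    { toFun := fun a => MulOpposite.op (φ (MulOpposite.op a))
      map_one' := by simp
      map_zero' := by simp
      map_mul' := by simp
      map_add' := by simp },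
    MulOpposite.op_injective.comp (hφ.comp MulOpposite.op_injective)⟩

end Opposite

/-- The first conjunct says that `Q(A)` exists; the second treats `Q(A)` in any of its models,
these being canonically isomorphic. -/
theorem corollary6p3 (k : Type u) [Field k] [Uncountable k]
    (A : Type v) [Ring A] [IsDomain A] [Algebra k A] (hfg : Algebra.FiniteType k A)
    (hPI : ¬ SatisfiesPolynomialIdentity k A) (hGK : gkDim k A < 3)
    (halg : ¬ Algebra.IsAlgebraic k A) :
    (∃ (D : Type v) (_ : DivisionRing D) (_ : Algebra k D) (ι : A →ₐ[k] D),
      IsQuotientDivisionAlgebra ι) ∧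
    ∀ x : A, Transcendental k x →
      ∀ (D : Type w) [DivisionRing D] [Algebra k D] (ι : A →ₐ[k] D),
        IsQuotientDivisionAlgebra ι →
          ¬ IsLeftAlgebraicOver (adjoinSimple k (ι x)) ∧
          ¬ IsRightAlgebraicOver (adjoinSimple k (ι x)) := by
  refine ⟨exists_isQuotientDivisionAlgebra hGK,
    fun x hx D _ _ ι hι => ⟨fun h => hPI ?_, fun h => hPI ?_⟩⟩
  · obtain ⟨F, _, E, _, _, _, φ, hφ⟩ :=
      exists_injective_ringHom_of_isLeftAlgebraicOver hfg hGK ι hι.injective hx h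
    exact satisfiesPolynomialIdentity_of_injective_ringHom (F := F) φ hφ
  · obtain ⟨F, _, E, _, _, _, φ, hφ⟩ :=
      exists_injective_ringHom_of_isRightAlgebraicOver hfg hGK ι hι.injective hx h
    exact satisfiesPolynomialIdentity_of_injective_ringHom (F := F) φ hφ
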